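/- Conventions. Functions are complex valued on $\mathbb R^3$. The support of a function is its essential support, i.e. the complement of the largest open set on which it vanishes almost everywhere, and the distance of two sets is $+\infty$ if one of them is empty. If $m$ is smooth on $\mathbb R^3\setminus\{0\}$ and homogeneous of degree zero, i.e. $m(\lambda\xi)=m(\xi)$ for all $\lambda>0$, then $m$ is bounded on $\mathbb R^3\setminus\{0\}$, and the operator $T$ with Fourier symbol $m$ is defined on $L^1(\mathbb R^3)$ by $Tf=\mathcal F^{-1}(m\,\mathcal Ff)$, which is a tempered distribution. For a tempered distribution $u$ and $g\in L^1(\mathbb R^3)$ the pairing $\langle u,g\rangle$ is defined if $u$ is given, on some open neighbourhood of $\operatorname{supp} g$, by a locally integrable function $h$ such that $hg$ is integrable, and then $\langle u,g\rangle=\int hg\,dx$ (no complex conjugation). $\mathcal R_j$ is the Riesz transform, with symbol $-i\xi_j/|\xi|$; products of powers of Riesz transforms are the operators whose symbols are the corresponding products of powers. For $x\in\mathbb R^3$, $\bar x=(x_1,x_2)$. (1) Let $T$ be the operator on $\mathbb R^3$ with Fourier symbol $m$, where $m:\mathbb R^3\setminus\{0\}\to\mathbb C$ is smooth and homogeneous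 of degree zero. There is a constant $C\in(0,\infty)$ depending only on $m$ such that for all $f,g\in L^1(\mathbb R^3)$ with disjoint supports: $\langle Tf,g\rangle$ is defined whenever $\operatorname{dist}(\operatorname{supp} f,\operatorname{supp} g)>0$, and whenever it is defined, $$|\langle Tf,g\rangle|\le C\,\operatorname{dist}(\operatorname{supp} f,\operatorname{supp} g)^{-3}\,\|g\|_{L^1}\|f\|_{L^1}$$ (with $0^{-3}=\infty$, $\infty^{-3}=0$; for disjoint supports at distance zero nothing is asserted). (2) For every $i\in\{1,2,3\}$ and $d>0$ there is a constant $C\in(0,\infty)$ such that for all $\gamma_1,\gamma_2>0$ with $\gamma_2-\gamma_1=d$, all $R>0$, and all $f,g\in L^1(\mathbb R^3)$ with $f$ supported in $\{|\bar x|\ge\gamma_2R\}$ and $g$ supported in $\{|\bar x|\le\gamma_1R\}$, the pairing $\langle\mathcal R_i^4f,g\rangle$ is defined and $$|\langle\mathcal R_i^4f,g\rangle|\le C R^{-3}\|g\|_{L^1}\|f\|_{L^1}.$$ (3) For every $k,h\in\{1,2,3\}$ and $d>0$ there is a constant $C\in(0,\infty)$ such that, for all $\gamma_1,\gamma_2,R,f,g$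 as in (2), the pairing $\langle\mathcal R_k^2\mathcal R_h^2f,g\rangle$ is defined and $$|\langle\mathcal R_k^2\mathcal R_h^2f,g\rangle|\le C R^{-3}\|g\|_{L^1}\|f\|_{L^1}.$$ -/

import Mathlib

open MeasureTheory FourierTransform SchwartzMap
open scoped ENNReal NNReal ContDiff

namespace ZeroDegree

/-- Three dimensional Euclidean space. -/
abbrev R3 : Type := EuclideanSpace ℝ (Fin 3)

/-- `m` is smooth on `ℝ³ \ {0}` and homogeneous of degree zero.
The value `m 0` is irrelevant. -/
structure IsZeroDegreeSymbol (m : R3 → ℂ) : Prop where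
  smooth : ContDiffOn ℝ ∞ m {0}ᶜ
  homogeneous : ∀ r : ℝ, 0 < r → ∀ ξ : R3, m (r • ξ) = m ξ

namespace IsZeroDegreeSymbol

theorem mul {m n : R3 → ℂ} (hm : IsZeroDegreeSymbol m) (hn : IsZeroDegreeSymbol n) :
    IsZeroDegreeSymbol (m * n) where
  smooth := hm.smooth.mul hn.smooth
  homogeneous r hr ξ := by
    simp only [Pi.mul_apply, hm.homogeneous r hr ξ, hn.homogeneous r hr ξ]

theorem pow {m : R3 → ℂ} (hm : IsZeroDegreeSymbol m) (k : ℕ) :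
    IsZeroDegreeSymbol (m ^ k) where
  smooth := hm.smooth.pow k
  homogeneous r hr ξ := by
    simp only [Pi.pow_apply, hm.homogeneous r hr ξ]

/-- A zero degree symbol is essentially bounded. -/
theorem memLp_top {m : R3 → ℂ} (hm : IsZeroDegreeSymbol m) : MemLp m ∞ (volume : Measure R3) := by
  have hc : ContinuousOn m {0}ᶜ := hm.smooth.continuousOn
  have hsub : Metric.sphere (0 : R3) 1 ⊆ {0}ᶜ := by
    intro x hx h0
    rw [Set.mem_singleton_iff] at h0
    simp [h0] at hx
  obtain ⟨C, hC⟩ := (isCompact_sphere (0 : R3) 1).exists_bound_of_continuousOn (hc.mono hsub)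
  have hne : ∀ᵐ ξ : R3 ∂volume, ξ ∈ ({0}ᶜ : Set R3) := by
    rw [ae_iff]
    simp
  refine memLp_top_of_bound ?_ C ?_
  · have h := hc.aestronglyMeasurable (μ := volume) (measurableSet_singleton (0 : R3)).compl
    rwa [Measure.restrict_eq_self_of_ae_mem hne] at h
  · filter_upwards [hne] with ξ hξ
    have hpos : 0 < ‖ξ‖ := norm_pos_iff.mpr hξ
    rw [← hm.homogeneous ‖ξ‖⁻¹ (inv_pos.mpr hpos) ξ]
    apply hC
    simp [norm_smul, hpos.ne']

/-- If `m` is a zero degree symbol and `f ∈ L¹`, then `m · 𝓕 f` is essentially bounded. -/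
theorem memLp_mul_fourier {m : R3 → ℂ} (hm : IsZeroDegreeSymbol m) {f : R3 → ℂ}
    (hf : Integrable f) : MemLp (fun ξ ↦ m ξ * 𝓕 f ξ) ∞ (volume : Measure R3) := by
  have h2 : MemLp (𝓕 f) ∞ (volume : Measure R3) := by
    refine memLp_top_of_bound ?_ (∫ v, ‖f v‖) (Filter.Eventually.of_forall fun ξ ↦ ?_)
    · exact (VectorFourier.fourierIntegral_continuous Real.continuous_fourierChar
        (by exact continuous_inner) hf).aestronglyMeasurable
    · exact VectorFourier.norm_fourierIntegral_le_integral_norm _ _ _ _ _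
  exact h2.mul hm.memLp_top

end IsZeroDegreeSymbol

/-- The operator `T` with Fourier symbol `m`, on `L¹`: `T f = 𝓕⁻¹ (m · 𝓕 f)`, where `𝓕 f` is the
Fourier integral of `f`, the bounded function `m · 𝓕 f` is regarded as a tempered distribution, and
`𝓕⁻¹` is the inverse Fourier transform of tempered distributions. Since `m` is homogeneous of degree
zero, `T` is the same operator for the normalization `∫ exp (-i x·ξ) f(x) dx` of the
Fourier transform as for Mathlib's normalization `∫ exp (-2π i x·ξ) f(x) dx`. -/
noncomputable def multiplierOp (m : R3 → ℂ) (hm : IsZeroDegreeSymbol m)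
    (f : R3 → ℂ) (hf : Integrable f) : 𝓢'(R3, ℂ) :=
  𝓕⁻ (((hm.memLp_mul_fourier hf).toLp (fun ξ ↦ m ξ * 𝓕 f ξ) : Lp ℂ ∞ (volume : Measure R3)) :
    𝓢'(R3, ℂ))

/-- The support of a (class of a) measurable function: the complement of the
largest open set on which `f` vanishes almost everywhere. -/
def essSupport (f : R3 → ℂ) : Set R3 :=
  {x | ∀ U ∈ nhds x, ¬ f =ᵐ[volume.restrict U] 0}

/-- The distance of two sets, with value `∞` if one of them is empty. -/
noncomputable def setEDist (s t : Set R3) : ℝ≥0∞ :=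
  ⨅ x ∈ s, ⨅ y ∈ t, edist x y

/-- On the open set `U`, the distribution `u` is given by the locally integrable function `h`. -/
def RepresentedOn (u : 𝓢'(R3, ℂ)) (h : R3 → ℂ) (U : Set R3) : Prop :=
  LocallyIntegrableOn h U ∧
    ∀ φ : 𝓢(R3, ℂ), HasCompactSupport φ → tsupport φ ⊆ U → u φ = ∫ x, h x * φ x

/-- `⟨u, g⟩ = z` in the sense `∫ u g dx = z`: the distribution `u` is given on some
open neighbourhood of the support of `g` by a locally integrable function `h` such that `h g` is
integrable, and `z = ∫ h g`. The pairing is bilinear (no complex conjugation). -/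
def HasPairing (u : 𝓢'(R3, ℂ)) (g : R3 → ℂ) (z : ℂ) : Prop :=
  ∃ (U : Set R3) (h : R3 → ℂ), IsOpen U ∧ essSupport g ⊆ U ∧ RepresentedOn u h U ∧
    Integrable (fun x ↦ h x * g x) ∧ z = ∫ x, h x * g x

/-- The symbol `-i ξⱼ / |ξ|` of the `j`-th Riesz transform. -/
noncomputable def rieszSymbol (j : Fin 3) (ξ : R3) : ℂ :=
  -Complex.I * (((ξ j / ‖ξ‖ : ℝ)) : ℂ)

theorem isZeroDegreeSymbol_riesz (j : Fin 3) : IsZeroDegreeSymbol (rieszSymbol j) where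
  smooth := by
    have h1 : ContDiffOn ℝ ∞ (fun ξ : R3 ↦ ξ j / ‖ξ‖) {0}ᶜ := by
      refine ContDiffOn.div (by fun_prop) (fun x hx ↦ ?_) (fun x hx ↦ norm_ne_zero_iff.mpr hx)
      exact (contDiffAt_norm ℝ hx).contDiffWithinAt
    exact contDiffOn_const.mul (Complex.ofRealCLM.contDiff.comp_contDiffOn h1)
  homogeneous r hr ξ := by
    simp only [rieszSymbol, PiLp.smul_apply, smul_eq_mul, norm_smul, Real.norm_eq_abs,
      abs_of_pos hr, mul_div_mul_left _ _ hr.ne']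

/-- `|x̄|`, where `x̄ = (x₁, x₂)`: the distance of `x` to the third axis. -/
noncomputable def cylRadius (x : R3) : ℝ := Real.sqrt (x 0 ^ 2 + x 1 ^ 2)

end ZeroDegree

open ZeroDegree

/-! Off the origin, the inverse Fourier transform of a degree-zero symbol on `ℝ³` is a function `K`
with `‖K x‖ ≤ C ‖x‖⁻³`. To see this, split `m = ∑ₙ p(2ⁿ ·)` dyadically with one test function `p`.
The pieces have kernels `2⁻³ⁿ k(2⁻ⁿ x)` with `k = 𝓕⁻ p` Schwartz, and boundedness together with
fourth-order decay of `k` makes the sum of their absolute values `O(‖x‖⁻³)`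
(`exists_dyadic_sum_bound`, `IsZeroDegreeSymbol.exists_kernel`).

By duality and Fubini, `T f` is then given by `K * f` on the complement of the support of `f`
(`representedOn_kernelConv`). By uniqueness of densities (`RepresentedOn.ae_eq`), every admissible
pairing equals `∫ (K * f) g`, and the kernel bound gives the estimate (`exists_pairing_bound`). The
Riesz statements are special cases: the two cylindrical regions lie at distance at least `d R`. -/

namespace ZeroDegree

open Filter Topology

/-! ### Dyadic decomposition of the symbol -/

namespace IsZeroDegreeSymbol

theorem exists_norm_le {m : R3 → ℂ} (hm : IsZeroDegreeSymbol m) : ∃ B : ℝ, ∀ ξ, ‖m ξ‖ ≤ B := by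
  have hsub : Metric.sphere (0 : R3) 1 ⊆ {0}ᶜ := by
    intro x hx h0
    rw [Set.mem_singleton_iff] at h0
    simp [h0] at hx
  obtain ⟨C, hC⟩ := (isCompact_sphere (0 : R3) 1).exists_bound_of_continuousOn
    (hm.smooth.continuousOn.mono hsub)
  refine ⟨max C ‖m 0‖, fun ξ ↦ ?_⟩
  rcases eq_or_ne ξ 0 with rfl | hξ
  · exact le_max_right _ _
  · have hpos : 0 < ‖ξ‖ := norm_pos_iff.mpr hξ
    rw [← hm.homogeneous ‖ξ‖⁻¹ (inv_pos.mpr hpos) ξ]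
    refine (hC _ ?_).trans (le_max_left _ _)
    simp [norm_smul, hpos.ne']

theorem aestronglyMeasurable {m : R3 → ℂ} (hm : IsZeroDegreeSymbol m) :
    AEStronglyMeasurable m (volume : Measure R3) :=
  hm.memLp_top.aestronglyMeasurable

/-- A zero degree symbol is the sum of the dilates of a test function. -/
theorem exists_dyadic_decomposition {m : R3 → ℂ} (hm : IsZeroDegreeSymbol m) :
    ∃ (p : 𝓢(R3, ℂ)) (B : ℝ),
      (∀ (N : ℕ) ξ, ‖∑ n ∈ Finset.Ico (-N : ℤ) N, p ((2 : ℝ) ^ n • ξ)‖ ≤ B) ∧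
      ∀ ξ, ξ ≠ 0 →
        Tendsto (fun N : ℕ ↦ ∑ n ∈ Finset.Ico (-N : ℤ) N, p ((2 : ℝ) ^ n • ξ)) atTop (𝓝 (m ξ)) := by
  obtain ⟨B, hB⟩ := hm.exists_norm_le
  -- `θ` is `1` on the unit ball and `0` outside the ball of radius `2`, so `χ` lives on an annulus.
  -- The dilates of `χ` telescope, and multiplying `m` by `χ` removes its singularity at the origin.
  let θ : ContDiffBump (0 : R3) := ⟨1, 2, one_pos, one_lt_two⟩
  let χ : R3 → ℝ := fun ξ ↦ θ ξ - θ ((2 : ℝ) • ξ)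
  have hχ : ContDiff ℝ ∞ χ := by
    have h2 : ContDiff ℝ ∞ fun ξ : R3 ↦ (2 : ℝ) • ξ := by fun_prop
    exact θ.contDiff.sub (θ.contDiff.comp h2)
  have hχ0 : χ =ᶠ[𝓝 0] 0 := by
    filter_upwards [Metric.ball_mem_nhds (0 : R3) (show (0 : ℝ) < 1 / 2 by norm_num)] with ξ hξ
    rw [mem_ball_zero_iff] at hξ
    have h1 : θ ξ = 1 := θ.one_of_mem_closedBall (by
      rw [mem_closedBall_zero_iff]; change ‖ξ‖ ≤ 1; linarith)
    have h2 : θ ((2 : ℝ) • ξ) = 1 := θ.one_of_mem_closedBall (by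
      rw [mem_closedBall_zero_iff, norm_smul]; change ‖(2 : ℝ)‖ * ‖ξ‖ ≤ 1; norm_num; linarith)
    simp [χ, h1, h2]
  have hθ0 : ∀ ξ : R3, 2 ≤ ‖ξ‖ → θ ξ = 0 := fun ξ hξ ↦
    θ.zero_of_le_dist (by rw [dist_zero_right]; exact hξ)
  let q : R3 → ℂ := fun ξ ↦ m ξ * (χ ξ : ℂ)
  have hq : ContDiff ℝ ∞ q := by
    rw [contDiff_iff_contDiffAt]
    intro ξ
    rcases eq_or_ne ξ 0 with rfl | hξ
    · refine contDiffAt_const (c := (0 : ℂ)) |>.congr_of_eventuallyEq ?_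
      filter_upwards [hχ0] with ξ hξ
      simp [q, hξ]
    · exact ((hm.smooth.contDiffAt (isOpen_compl_singleton.mem_nhds hξ))).mul
        (Complex.ofRealCLM.contDiff.comp hχ).contDiffAt
  have hqc : HasCompactSupport q := by
    refine HasCompactSupport.intro (isCompact_closedBall (0 : R3) 2) fun ξ hξ ↦ ?_
    rw [mem_closedBall_zero_iff, not_le] at hξ
    have h2 : θ ((2 : ℝ) • ξ) = 0 := hθ0 _ (by rw [norm_smul]; norm_num; linarith)
    simp [q, χ, hθ0 ξ hξ.le, h2]
  have hsum : ∀ (N : ℕ) ξ, ∑ n ∈ Finset.Ico (-N : ℤ) N, q ((2 : ℝ) ^ n • ξ) =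
      m ξ * ((θ ((2 : ℝ) ^ (-N : ℤ) • ξ) - θ ((2 : ℝ) ^ (N : ℤ) • ξ) : ℝ) : ℂ) := by
    intro N ξ
    rw [← Finset.sum_Ico_int_sub N (fun n : ℤ ↦ θ ((2 : ℝ) ^ n • ξ)), Complex.ofReal_sum,
      Finset.mul_sum]
    refine Finset.sum_congr rfl fun n _ ↦ ?_
    simp only [q, χ, hm.homogeneous _ (zpow_pos two_pos n), smul_smul]
    rw [zpow_add₀ two_ne_zero, zpow_one, mul_comm (2 : ℝ)]
  refine ⟨hqc.toSchwartzMap hq, B * 1, fun N ξ ↦ ?_, fun ξ hξ ↦ ?_⟩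
  · change ‖∑ n ∈ Finset.Ico (-N : ℤ) N, q ((2 : ℝ) ^ n • ξ)‖ ≤ B * 1
    rw [hsum, norm_mul, Complex.norm_real, Real.norm_eq_abs]
    refine mul_le_mul (hB ξ) ?_ (abs_nonneg _) ((norm_nonneg _).trans (hB ξ))
    rw [abs_le]
    constructor <;>
    linarith [θ.nonneg' ((2 : ℝ) ^ (-N : ℤ) • ξ), θ.nonneg' ((2 : ℝ) ^ (N : ℤ) • ξ),
      θ.le_one (x := (2 : ℝ) ^ (-N : ℤ) • ξ), θ.le_one (x := (2 : ℝ) ^ (N : ℤ) • ξ)]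
  · change Tendsto (fun N : ℕ ↦ ∑ n ∈ Finset.Ico (-N : ℤ) N, q ((2 : ℝ) ^ n • ξ)) atTop (𝓝 (m ξ))
    have hpow : Tendsto (fun N : ℕ ↦ (2 : ℝ) ^ N * ‖ξ‖) atTop atTop :=
      (tendsto_pow_atTop_atTop_of_one_lt one_lt_two).atTop_mul_const (norm_pos_iff.mpr hξ)
    -- For large `N` the telescoped factor is exactly `1 - 0`, so the partial sums are eventually
    -- equal to `m ξ`.
    refine tendsto_const_nhds.congr' ?_
    filter_upwards [hpow.eventually_ge_atTop 2,
      (tendsto_pow_atTop_atTop_of_one_lt (one_lt_two (α := ℝ))).eventually_ge_atTop ‖ξ‖]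
      with N h1 h2
    have h3 : θ ((2 : ℝ) ^ (N : ℤ) • ξ) = 0 := hθ0 _ (by
      rw [norm_smul, zpow_natCast, norm_pow]; simpa using h1)
    have h4 : θ ((2 : ℝ) ^ (-N : ℤ) • ξ) = 1 := θ.one_of_mem_closedBall (by
      rw [mem_closedBall_zero_iff, norm_smul, zpow_neg, zpow_natCast, norm_inv, norm_pow]
      rw [Real.norm_ofNat]
      change ((2 : ℝ) ^ N)⁻¹ * ‖ξ‖ ≤ 1
      rw [inv_mul_le_iff₀ (by positivity), mul_one]
      exact h2)
    rw [hsum, h3, h4]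
    simp

end IsZeroDegreeSymbol

/-! ### Summation of the dilated kernels -/

/-- The dilates of a kernel that is bounded and decays to fourth order sum up to a kernel of size
`‖x‖⁻³`. -/
theorem exists_dyadic_sum_bound {a : R3 → ℝ} {A : ℝ} (ha0 : ∀ x, 0 ≤ a x)
    (ha : ∀ x, a x ≤ A) (ha4 : ∀ x, ‖x‖ ^ 4 * a x ≤ A) :
    ∃ C : ℝ, 0 < C ∧ ∀ x, x ≠ 0 →
      Summable (fun n : ℤ ↦ (((2 : ℝ) ^ n)⁻¹) ^ 3 * a (((2 : ℝ) ^ n)⁻¹ • x)) ∧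
      ∑' n : ℤ, (((2 : ℝ) ^ n)⁻¹) ^ 3 * a (((2 : ℝ) ^ n)⁻¹ • x) ≤ C * ‖x‖⁻¹ ^ 3 := by
  have hA : 0 ≤ A := (ha0 0).trans (ha 0)
  -- Majorant of `‖x‖ ^ 3 * a x` on the shell `2 ^ k ≤ ‖x‖ < 2 ^ (k + 1)`. For `k ≥ 0`, fourth-order
  -- decay leaves a factor `‖x‖⁻¹ ≤ 2 ^ (-k)`. For `k < 0`, boundedness of `a` suffices; the `8` is
  -- the cube of the ratio of the shell's radii.
  let w : ℤ → ℝ := fun k ↦ 8 * A * (1 / 2) ^ k.natAbs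
  have hw : Summable w := by
    have hg : Summable fun n : ℕ ↦ 8 * A * (1 / 2 : ℝ) ^ n :=
      (summable_geometric_of_lt_one (by norm_num) (by norm_num)).mul_left _
    refine Summable.of_nat_of_neg ?_ ?_ <;> simpa [w] using hg
  have hw0 : ∀ k, 0 ≤ w k := fun k ↦ by positivity
  have key : ∀ (k : ℤ) (x : R3), (2 : ℝ) ^ k ≤ ‖x‖ → ‖x‖ < (2 : ℝ) ^ (k + 1) →
      ‖x‖ ^ 3 * a x ≤ w k := by
    intro k x h1 h2
    have hr : 0 < ‖x‖ := (zpow_pos two_pos k).trans_le h1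
    rcases le_or_gt 0 k with hk | hk
    · obtain ⟨n, rfl⟩ := Int.eq_ofNat_of_zero_le hk
      have h3 : ‖x‖ ^ 3 * a x ≤ A * ‖x‖⁻¹ := by
        rw [← div_eq_mul_inv, le_div_iff₀ hr]
        calc _ = ‖x‖ ^ 4 * a x := by ring
          _ ≤ A := ha4 x
      have h4 : ‖x‖⁻¹ ≤ (1 / 2 : ℝ) ^ n := by
        rw [one_div, inv_pow]
        rw [zpow_natCast] at h1
        exact inv_anti₀ (by positivity) h1
      calc _ ≤ A * ‖x‖⁻¹ := h3
        _ ≤ A * (1 / 2 : ℝ) ^ n := by gcongr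
        _ ≤ w n := by
          simp only [w, Int.natAbs_natCast]
          have : 0 ≤ A * (1 / 2 : ℝ) ^ n := by positivity
          linarith
    · obtain ⟨n, rfl⟩ : ∃ n : ℕ, k = -(n : ℤ) := ⟨k.natAbs, by omega⟩
      have h3 : ‖x‖ ≤ 2 * (1 / 2 : ℝ) ^ n := by
        rw [zpow_add₀ two_ne_zero, zpow_one, zpow_neg, zpow_natCast, ← inv_pow, ← one_div] at h2
        linarith
      have h5 : (1 / 2 : ℝ) ^ n ≤ 1 := pow_le_one₀ (by norm_num) (by norm_num)
      have h4 : ‖x‖ ^ 3 ≤ 8 * (1 / 2 : ℝ) ^ n := by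
        calc ‖x‖ ^ 3 ≤ (2 * (1 / 2 : ℝ) ^ n) ^ 3 := by gcongr
          _ = 8 * (1 / 2 : ℝ) ^ n * ((1 / 2 : ℝ) ^ n) ^ 2 := by ring
          _ ≤ 8 * (1 / 2 : ℝ) ^ n * 1 := by gcongr; exact pow_le_one₀ (by positivity) h5
          _ = _ := mul_one _
      calc ‖x‖ ^ 3 * a x ≤ 8 * (1 / 2 : ℝ) ^ n * A := by
            gcongr
            · exact ha0 x
            · exact ha x
        _ = w (-n) := by simp only [w, Int.natAbs_neg, Int.natAbs_natCast]; ring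
  -- The `+ 1` only keeps the constant positive when `A = 0`.
  refine ⟨(∑' k, w k) + 1, by have : 0 ≤ ∑' k, w k := tsum_nonneg hw0; linarith, fun x hx ↦ ?_⟩
  have hr : 0 < ‖x‖ := norm_pos_iff.mpr hx
  -- If `x` lies in shell `k`, its `n`-th rescaling lies in shell `k - n`; reindexing makes the sum
  -- of the majorants independent of `k`.
  obtain ⟨k, hk1, hk2⟩ := exists_mem_Ico_zpow hr (one_lt_two (α := ℝ))
  have hle : ∀ n : ℤ,
      (((2 : ℝ) ^ n)⁻¹) ^ 3 * a (((2 : ℝ) ^ n)⁻¹ • x) ≤ w (k - n) * ‖x‖⁻¹ ^ 3 := by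
    intro n
    have hn : 0 < ((2 : ℝ) ^ n)⁻¹ := by positivity
    have hnorm : ‖((2 : ℝ) ^ n)⁻¹ • x‖ = ((2 : ℝ) ^ n)⁻¹ * ‖x‖ := by
      rw [norm_smul, Real.norm_of_nonneg hn.le]
    have h := key (k - n) (((2 : ℝ) ^ n)⁻¹ • x)
      (by rw [hnorm, zpow_sub₀ two_ne_zero, div_eq_inv_mul]; gcongr)
      (by rw [hnorm, show k - n + 1 = k + 1 - n by ring, zpow_sub₀ two_ne_zero, div_eq_inv_mul]
          gcongr)
    calc (((2 : ℝ) ^ n)⁻¹) ^ 3 * a (((2 : ℝ) ^ n)⁻¹ • x)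
        = (‖((2 : ℝ) ^ n)⁻¹ • x‖ ^ 3 * a (((2 : ℝ) ^ n)⁻¹ • x)) * ‖x‖⁻¹ ^ 3 := by
          rw [hnorm]; field_simp
      _ ≤ _ := by gcongr
  have hws : Summable fun n ↦ w (k - n) * ‖x‖⁻¹ ^ 3 :=
    ((Equiv.subLeft k).summable_iff.mpr hw).mul_right _
  have hs : Summable (fun n : ℤ ↦ (((2 : ℝ) ^ n)⁻¹) ^ 3 * a (((2 : ℝ) ^ n)⁻¹ • x)) :=
    Summable.of_nonneg_of_le (fun n ↦ mul_nonneg (by positivity) (ha0 _)) hle hws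
  refine ⟨hs, (hs.tsum_le_tsum hle hws).trans ?_⟩
  have hshift : ∑' n, w (k - n) = ∑' n, w n := (Equiv.subLeft k).tsum_eq w
  rw [tsum_mul_right, hshift]
  gcongr
  linarith

/-! ### Fourier identities and the kernel of a symbol -/

theorem fourierInv_comp_smul (p : R3 → ℂ) {r : ℝ} (hr : 0 < r) (x : R3) :
    𝓕⁻ (fun ξ ↦ p (r • ξ)) x = ((r⁻¹ ^ 3 : ℝ) : ℂ) * 𝓕⁻ p (r⁻¹ • x) := by
  rw [Real.fourierInv_eq, Real.fourierInv_eq]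
  have h := Measure.integral_comp_smul (volume : Measure R3)
    (fun ξ : R3 ↦ Real.fourierChar (inner ℝ ξ (r⁻¹ • x)) • p ξ) r
  rw [finrank_euclideanSpace_fin, abs_of_pos (by positivity), ← inv_pow] at h
  rw [← Complex.real_smul, ← h]
  refine integral_congr_ae (Eventually.of_forall fun ξ ↦ ?_)
  simp only [real_inner_smul_left, real_inner_smul_right]
  rw [inv_mul_cancel_left₀ hr.ne']

theorem integrable_comp_smul_schwartz (p : 𝓢(R3, ℂ)) {r : ℝ} (hr : 0 < r) :
    Integrable fun ξ : R3 ↦ p (r • ξ) :=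
  (integrable_comp_smul_iff volume _ hr.ne').mpr p.integrable

theorem norm_fourierChar_smul (t : ℝ) (z : ℂ) : ‖Real.fourierChar t • z‖ = ‖z‖ :=
  Circle.norm_smul _ _

/-- The multiplication formula `∫ â b = ∫ a b̂`, applied to the reflected `φ` and a modulation of
`v`. It gives the kernel of the transposed operator for an integrable symbol, such as a partial
dyadic sum. -/
theorem fourier_mul_fourierInv (v : R3 → ℂ) (hv : Integrable v) (φ : 𝓢(R3, ℂ)) (y : R3) :
    𝓕 (fun ξ ↦ v ξ * (𝓕⁻ φ) ξ) y = ∫ x, 𝓕⁻ v (x - y) * φ x := by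
  have hφ : Integrable fun x ↦ φ (-x) := φ.integrable.comp_neg
  have hve : Integrable fun ξ : R3 ↦ Real.fourierChar (-(inner ℝ ξ y)) • v ξ :=
    (Real.fourierIntegral_convergent_iff y).mpr hv
  have h := VectorFourier.integral_fourierIntegral_smul_eq_flip (L := innerₗ R3)
    Real.continuous_fourierChar continuous_inner hφ hve
  have hl : 𝓕 (fun ξ ↦ v ξ * (𝓕⁻ φ) ξ) y =
      ∫ ξ, 𝓕 (fun x ↦ φ (-x)) ξ • Real.fourierChar (-(inner ℝ ξ y)) • v ξ := by
    rw [Real.fourier_eq]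
    refine integral_congr_ae (Eventually.of_forall fun ξ ↦ ?_)
    have : (𝓕⁻ φ) ξ = 𝓕 (fun x ↦ φ (-x)) ξ := by
      rw [SchwartzMap.fourierInv_coe, Real.fourierInv_eq_fourier_comp_neg]
    simp only [this, smul_eq_mul, Circle.smul_def]
    ring
  rw [hl]
  refine Eq.trans h ?_
  rw [← integral_neg_eq_self]
  refine integral_congr_ae (Eventually.of_forall fun x ↦ ?_)
  simp only [neg_neg, smul_eq_mul]
  rw [mul_comm]
  congr 1
  rw [Real.fourierInv_eq]
  refine integral_congr_ae (Eventually.of_forall fun ξ ↦ ?_)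
  simp only [LinearMap.flip_apply, innerₗ_apply_apply, Circle.smul_def, smul_eq_mul]
  rw [← mul_assoc, ← Circle.coe_mul, ← AddChar.map_add_eq_mul]
  congr 3
  rw [inner_sub_right, inner_neg_left, real_inner_comm ξ x]
  ring

namespace IsZeroDegreeSymbol

/-- Away from the origin, the inverse Fourier transform of a zero degree symbol is a function of
size `‖x‖⁻³`. -/
theorem exists_kernel {m : R3 → ℂ} (hm : IsZeroDegreeSymbol m) :
    ∃ (K : R3 → ℂ) (C : ℝ), 0 < C ∧ StronglyMeasurable K ∧
      (∀ x, x ≠ 0 → ‖K x‖ ≤ C * ‖x‖⁻¹ ^ 3) ∧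
      ∀ (φ : 𝓢(R3, ℂ)) (y : R3), y ∉ tsupport φ →
        𝓕 (fun ξ ↦ m ξ * (𝓕⁻ φ) ξ) y = ∫ x, K (x - y) * φ x := by
  obtain ⟨p, B, hB, hlim⟩ := hm.exists_dyadic_decomposition
  set k : 𝓢(R3, ℂ) := 𝓕⁻ p with hk
  obtain ⟨A₀, hA₀⟩ : ∃ A, ∀ x, ‖k x‖ ≤ A :=
    ⟨_, fun x ↦ by simpa using SchwartzMap.le_seminorm ℝ 0 0 k x⟩
  obtain ⟨A₄, hA₄⟩ : ∃ A, ∀ x, ‖x‖ ^ 4 * ‖k x‖ ≤ A :=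
    ⟨_, fun x ↦ by simpa using SchwartzMap.le_seminorm ℝ 4 0 k x⟩
  obtain ⟨C, hC, hsum⟩ := exists_dyadic_sum_bound (a := fun x ↦ ‖k x‖) (A := max A₀ A₄)
    (fun x ↦ norm_nonneg _) (fun x ↦ (hA₀ x).trans (le_max_left _ _))
    (fun x ↦ (hA₄ x).trans (le_max_right _ _))
  let q : ℤ → R3 → ℂ := fun n x ↦
    (((((2 : ℝ) ^ n)⁻¹ ^ 3 : ℝ)) : ℂ) * k (((2 : ℝ) ^ n)⁻¹ • x)
  have hqc : ∀ n, Continuous (q n) := fun n ↦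
    continuous_const.mul (k.continuous.comp (continuous_const_smul _))
  have hqn : ∀ n x, ‖q n x‖ = ((2 : ℝ) ^ n)⁻¹ ^ 3 * ‖k (((2 : ℝ) ^ n)⁻¹ • x)‖ := fun n x ↦ by
    have : 0 ≤ ((2 : ℝ) ^ n)⁻¹ ^ 3 := by positivity
    simp only [q, norm_mul, Complex.norm_real, Real.norm_of_nonneg this]
  have hqs : ∀ x, x ≠ 0 → Summable fun n ↦ ‖q n x‖ := fun x hx ↦ by
    simpa only [hqn] using (hsum x hx).1
  have hqb : ∀ x, x ≠ 0 → ∑' n, ‖q n x‖ ≤ C * ‖x‖⁻¹ ^ 3 := fun x hx ↦ by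
    simpa only [hqn] using (hsum x hx).2
  let S : ℕ → R3 → ℂ := fun N x ↦ ∑ n ∈ Finset.Ico (-N : ℤ) N, q n x
  have hSc : ∀ N, Continuous (S N) := fun N ↦ continuous_finsetSum _ fun n _ ↦ hqc n
  -- Convergence is known only off the origin; the indicator makes the cut-off partial sums converge
  -- everywhere, which yields measurability of `K`.
  let K : R3 → ℂ := ({0}ᶜ : Set R3).indicator fun x ↦ ∑' n, q n x
  have hSK : ∀ x, x ≠ 0 → Tendsto (fun N ↦ S N x) atTop (𝓝 (K x)) := fun x hx ↦ by
    have hx' : x ∈ ({0}ᶜ : Set R3) := hx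
    simp only [K, Set.indicator_of_mem hx']
    exact (hqs x hx).of_norm.hasSum.comp (Finset.tendsto_Ico_neg (R := ℤ))
  have hSb : ∀ N x, x ≠ 0 → ‖S N x‖ ≤ C * ‖x‖⁻¹ ^ 3 := fun N x hx ↦
    (norm_sum_le _ _).trans (((hqs x hx).sum_le_tsum _ fun _ _ ↦ norm_nonneg _).trans (hqb x hx))
  refine ⟨K, C, hC, ?_, fun x hx ↦ ?_, fun φ y hy ↦ ?_⟩
  · refine stronglyMeasurable_of_tendsto atTop
      (f := fun N ↦ ({0}ᶜ : Set R3).indicator (S N))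
      (fun N ↦ (hSc N).stronglyMeasurable.indicator (measurableSet_singleton 0).compl) ?_
    rw [tendsto_pi_nhds]
    intro x
    rcases eq_or_ne x 0 with rfl | hx
    · simp [K]
    · have hx' : x ∈ ({0}ᶜ : Set R3) := hx
      simpa only [Set.indicator_of_mem hx'] using hSK x hx
  · exact le_of_tendsto (hSK x hx).norm (Eventually.of_forall fun N ↦ hSb N x hx)
  · have hi : ∀ n : ℤ, Integrable fun ξ : R3 ↦ p ((2 : ℝ) ^ n • ξ) := fun n ↦
      integrable_comp_smul_schwartz p (zpow_pos two_pos n)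
    have hpc : ∀ N : ℕ, Continuous fun ξ : R3 ↦
        ∑ n ∈ Finset.Ico (-N : ℤ) N, p ((2 : ℝ) ^ n • ξ) := fun N ↦
      continuous_finsetSum _ fun n _ ↦ p.continuous.comp (continuous_const_smul _)
    have hinv : ∀ (N : ℕ) (x : R3),
        𝓕⁻ (fun ξ ↦ ∑ n ∈ Finset.Ico (-N : ℤ) N, p ((2 : ℝ) ^ n • ξ)) x = S N x := by
      intro N x
      have hq : ∀ n, q n x = 𝓕⁻ (fun ξ ↦ p ((2 : ℝ) ^ n • ξ)) x := fun n ↦ by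
        rw [fourierInv_comp_smul p (zpow_pos two_pos n)]
        simp only [q, hk, SchwartzMap.fourierInv_coe]
      simp only [S, hq, Real.fourierInv_eq, Finset.smul_sum]
      refine integral_finsetSum _ fun n _ ↦ ?_
      simpa using (Real.fourierIntegral_convergent_iff (-x)).mpr (hi n)
    have hpart : ∀ N : ℕ,
        𝓕 (fun ξ ↦ (∑ n ∈ Finset.Ico (-N : ℤ) N, p ((2 : ℝ) ^ n • ξ)) * (𝓕⁻ φ) ξ) y =
          ∫ x, S N (x - y) * φ x := fun N ↦ by
      rw [fourier_mul_fourierInv _ (integrable_finsetSum _ fun n _ ↦ hi n) φ y]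
      simp only [hinv]
    have hψ : Integrable (𝓕⁻ φ : 𝓢(R3, ℂ)) := SchwartzMap.integrable _
    have hne : ∀ᵐ ξ : R3, ξ ≠ 0 := by simp [ae_iff]
    -- On the frequency side, the uniform bound `B` on the partial symbols gives the dominating
    -- function.
    have h1 : Tendsto (fun N : ℕ ↦
        𝓕 (fun ξ ↦ (∑ n ∈ Finset.Ico (-N : ℤ) N, p ((2 : ℝ) ^ n • ξ)) * (𝓕⁻ φ) ξ) y) atTop
        (𝓝 (𝓕 (fun ξ ↦ m ξ * (𝓕⁻ φ) ξ) y)) := by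
      simp only [Real.fourier_eq]
      refine tendsto_integral_of_dominated_convergence (fun ξ ↦ B * ‖(𝓕⁻ φ) ξ‖) (fun N ↦ ?_)
        (hψ.norm.const_mul B) (fun N ↦ Eventually.of_forall fun ξ ↦ ?_) ?_
      · refine Continuous.aestronglyMeasurable ?_
        have h2 : Continuous fun ξ : R3 ↦ Real.fourierChar (-(inner ℝ ξ y)) :=
          Real.continuous_fourierChar.comp (by fun_prop)
        exact h2.smul ((hpc N).mul (𝓕⁻ φ : 𝓢(R3, ℂ)).continuous)
      · rw [norm_fourierChar_smul, norm_mul]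
        gcongr
        exact hB N ξ
      · filter_upwards [hne] with ξ hξ
        exact ((hlim ξ hξ).mul_const _).const_smul _
    refine tendsto_nhds_unique h1 ?_
    simp only [hpart]
    -- On the space side, `y` is at distance at least `ε` from the points where `φ ≠ 0`, so the
    -- partial kernels are bounded there by `C * ε⁻¹ ^ 3`, uniformly in `N`.
    obtain ⟨ε, hε, hball⟩ := Metric.isOpen_iff.mp (isClosed_tsupport φ).isOpen_compl y hy
    have hφ0 : ∀ x, φ x ≠ 0 → ε ≤ ‖x - y‖ := fun x hx ↦ by
      by_contra! h
      exact hball (by rwa [Metric.mem_ball, dist_eq_norm]) (subset_tsupport _ hx)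
    refine tendsto_integral_of_dominated_convergence (fun x ↦ C * ε⁻¹ ^ 3 * ‖φ x‖) (fun N ↦ ?_)
      (φ.integrable.norm.const_mul _) (fun N ↦ Eventually.of_forall fun x ↦ ?_)
      (Eventually.of_forall fun x ↦ ?_)
    · exact (((hSc N).comp (continuous_id.sub continuous_const)).mul
        φ.continuous).aestronglyMeasurable
    · rw [norm_mul]
      rcases eq_or_ne (φ x) 0 with h0 | h0
      · simp [h0]
      · have hle := hφ0 x h0
        gcongr
        refine (hSb N _ (norm_pos_iff.mp (hε.trans_le hle))).trans ?_
        gcongr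
    · rcases eq_or_ne (φ x) 0 with h0 | h0
      · simp [h0]
      · exact (hSK _ (norm_pos_iff.mp (hε.trans_le (hφ0 x h0)))).mul_const _

end IsZeroDegreeSymbol

/-! ### Essential supports and `T f` as a convolution off the support of `f` -/

theorem isClosed_essSupport (f : R3 → ℂ) : IsClosed (essSupport f) := by
  rw [← isOpen_compl_iff, isOpen_iff_mem_nhds]
  intro x hx
  simp only [essSupport, Set.mem_compl_iff, Set.mem_ofPred_eq, not_forall, not_not] at hx
  obtain ⟨U, hU, h⟩ := hx
  filter_upwards [eventually_mem_nhds_iff.mpr hU] with y hy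
  simp only [essSupport, Set.mem_compl_iff, Set.mem_ofPred_eq, not_forall, not_not]
  exact ⟨U, hy, h⟩

theorem ae_eq_zero_of_notMem_essSupport (f : R3 → ℂ) :
    ∀ᵐ x, x ∉ essSupport f → f x = 0 := by
  have h0 : volume {x | ¬ (x ∉ essSupport f → f x = 0)} = 0 := by
    refine measure_null_of_locally_null _ fun x hx ↦ ?_
    simp only [Set.mem_ofPred_eq, Classical.not_imp] at hx
    have hx' := hx.1
    simp only [essSupport, Set.mem_ofPred_eq, not_forall, not_not] at hx'
    obtain ⟨U, hU, h⟩ := hx'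
    refine ⟨_, inter_mem_nhdsWithin _ (interior_mem_nhds.mpr hU), ?_⟩
    have h2 := ae_restrict_of_ae_restrict_of_subset interior_subset h
    have h3 := (ae_restrict_iff' isOpen_interior.measurableSet).mp h2
    refine measure_mono_null ?_ (ae_iff.mp h3)
    rintro z ⟨hz1, hz2⟩
    simp only [Set.mem_ofPred_eq, Classical.not_imp] at hz1 ⊢
    exact ⟨hz2, hz1.2⟩
  exact ae_iff.mpr h0

/-- The multiplication formula moves the transform from `f` to the test side, so only the transposed
operator on Schwartz functions has to be understood. -/
theorem multiplierOp_apply {m : R3 → ℂ} (hm : IsZeroDegreeSymbol m) {f : R3 → ℂ}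
    (hf : Integrable f) (φ : 𝓢(R3, ℂ)) :
    multiplierOp m hm f hf φ = ∫ y, f y * 𝓕 (fun ξ ↦ m ξ * (𝓕⁻ φ) ξ) y := by
  obtain ⟨B, hB⟩ := hm.exists_norm_le
  have hg : Integrable fun ξ ↦ m ξ * (𝓕⁻ φ : 𝓢(R3, ℂ)) ξ :=
    (SchwartzMap.integrable _).bdd_mul hm.aestronglyMeasurable (Eventually.of_forall hB)
  have h := VectorFourier.integral_fourierIntegral_smul_eq_flip (L := innerₗ R3)
    Real.continuous_fourierChar continuous_inner hf hg
  rw [flip_innerₗ] at h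
  rw [multiplierOp, TemperedDistribution.fourierInv_apply, Lp.toTemperedDistribution_apply]
  refine Eq.trans (integral_congr_ae ?_) h
  filter_upwards [(hm.memLp_mul_fourier hf).coeFn_toLp] with ξ hξ
  rw [hξ, smul_eq_mul, smul_eq_mul]
  change _ = 𝓕 f ξ * _
  ring

/-- The convolution of a kernel with an integrable function. -/
noncomputable def kernelConv (K f : R3 → ℂ) (x : R3) : ℂ := ∫ y, K (x - y) * f y

theorem aestronglyMeasurable_kernel_prod {K f : R3 → ℂ} (hK : StronglyMeasurable K)
    (hf : Integrable f) :
    AEStronglyMeasurable (fun z : R3 × R3 ↦ K (z.1 - z.2) * f z.2)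
      ((volume : Measure R3).prod volume) :=
  (hK.comp_measurable (measurable_fst.sub measurable_snd)).aestronglyMeasurable.mul
    hf.aestronglyMeasurable.comp_snd

theorem aestronglyMeasurable_kernelConv {K f : R3 → ℂ} (hK : StronglyMeasurable K)
    (hf : Integrable f) : AEStronglyMeasurable (kernelConv K f) (volume : Measure R3) :=
  (aestronglyMeasurable_kernel_prod hK hf).integral_prod_right'

/-- The vanishing of `f` off its support is assumed at the single point `y`, so that it can be
supplied almost everywhere under an integral. -/
theorem norm_kernel_mul_le {K f : R3 → ℂ} {C : ℝ} (hC : 0 < C)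
    (hKb : ∀ x, x ≠ 0 → ‖K x‖ ≤ C * ‖x‖⁻¹ ^ 3) {ε : ℝ} (hε : 0 < ε) {x y : R3}
    (hy : y ∉ essSupport f → f y = 0) (hx : ∀ y ∈ essSupport f, ε ≤ dist x y) :
    ‖K (x - y) * f y‖ ≤ C * ε⁻¹ ^ 3 * ‖f y‖ := by
  by_cases hys : y ∈ essSupport f
  · have hle := hx y hys
    rw [dist_eq_norm] at hle
    rw [norm_mul]
    gcongr
    refine (hKb _ (norm_pos_iff.mp (hε.trans_le hle))).trans ?_
    gcongr
  · simp [hy hys]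

theorem norm_kernelConv_le {K f : R3 → ℂ} {C : ℝ} (hC : 0 < C)
    (hKb : ∀ x, x ≠ 0 → ‖K x‖ ≤ C * ‖x‖⁻¹ ^ 3) (hf : Integrable f) {ε : ℝ} (hε : 0 < ε)
    {x : R3} (hx : ∀ y ∈ essSupport f, ε ≤ dist x y) :
    ‖kernelConv K f x‖ ≤ C * ε⁻¹ ^ 3 * ∫ y, ‖f y‖ := by
  rw [← integral_const_mul]
  refine norm_integral_le_of_norm_le (hf.norm.const_mul _) ?_
  filter_upwards [ae_eq_zero_of_notMem_essSupport f] with y hy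
  exact norm_kernel_mul_le hC hKb hε hy hx

theorem locallyIntegrableOn_kernelConv {K f : R3 → ℂ} {C : ℝ} (hC : 0 < C)
    (hK : StronglyMeasurable K) (hKb : ∀ x, x ≠ 0 → ‖K x‖ ≤ C * ‖x‖⁻¹ ^ 3)
    (hf : Integrable f) : LocallyIntegrableOn (kernelConv K f) (essSupport f)ᶜ := by
  intro x hx
  obtain ⟨ε, hε, hball⟩ := Metric.isOpen_iff.mp (isClosed_essSupport f).isOpen_compl x hx
  refine ⟨Metric.ball x (ε / 2),
    mem_nhdsWithin_of_mem_nhds (Metric.ball_mem_nhds x (half_pos hε)), ?_⟩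
  refine Measure.integrableOn_of_bounded (M := C * (ε / 2)⁻¹ ^ 3 * ∫ y, ‖f y‖)
    measure_ball_lt_top.ne (aestronglyMeasurable_kernelConv hK hf) ?_
  refine (ae_restrict_iff' measurableSet_ball).mpr (Eventually.of_forall fun z hz ↦ ?_)
  refine norm_kernelConv_le hC hKb hf (half_pos hε) fun y hy ↦ ?_
  by_contra! h
  refine hball (?_ : y ∈ Metric.ball x ε) hy
  rw [Metric.mem_ball] at hz ⊢
  calc dist y x ≤ dist z y + dist z x := dist_triangle_left y x z
    _ < ε := by linarith

/-- Fubini applies because a compact set and a disjoint closed set have positive distance `ε`: the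
integrand is dominated by `C * ε⁻¹ ^ 3 * ‖φ x‖ * ‖f y‖`. -/
theorem integral_mul_integral_kernel {K f φ : R3 → ℂ} {C : ℝ} (hC : 0 < C)
    (hK : StronglyMeasurable K) (hKb : ∀ x, x ≠ 0 → ‖K x‖ ≤ C * ‖x‖⁻¹ ^ 3)
    (hf : Integrable f) (hφ : Integrable φ) (hφc : HasCompactSupport φ)
    (hφs : tsupport φ ⊆ (essSupport f)ᶜ) :
    ∫ y, f y * ∫ x, K (x - y) * φ x = ∫ x, kernelConv K f x * φ x := by
  obtain ⟨ε, hε, hdist⟩ : ∃ ε : ℝ, 0 < ε ∧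
      ∀ x ∈ tsupport φ, ∀ y ∈ essSupport f, ε ≤ dist x y := by
    obtain ⟨r, hr, h⟩ := Metric.exists_pos_forall_lt_edist hφc.isCompact (isClosed_essSupport f)
      (Set.disjoint_left.mpr fun x hx ↦ hφs hx)
    refine ⟨r, hr, fun x hx y hy ↦ ?_⟩
    have := h x hx y hy
    rw [edist_nndist, ENNReal.coe_lt_coe] at this
    exact_mod_cast this.le
  have hint : Integrable (fun z : R3 × R3 ↦ K (z.1 - z.2) * f z.2 * φ z.1)
      ((volume : Measure R3).prod volume) := by
    refine Integrable.mono' ((hφ.norm.mul_prod hf.norm).const_mul (C * ε⁻¹ ^ 3))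
      ((aestronglyMeasurable_kernel_prod hK hf).mul hφ.aestronglyMeasurable.comp_fst) ?_
    filter_upwards [Measure.quasiMeasurePreserving_snd.ae (ae_eq_zero_of_notMem_essSupport f)]
      with z hz
    rw [norm_mul]
    rcases eq_or_ne (φ z.1) 0 with h0 | h0
    · simp [h0]
    · calc _ ≤ C * ε⁻¹ ^ 3 * ‖f z.2‖ * ‖φ z.1‖ := by
            gcongr
            exact norm_kernel_mul_le hC hKb hε hz (hdist _ (subset_tsupport _ h0))
        _ = _ := by ring
  calc ∫ y, f y * ∫ x, K (x - y) * φ x = ∫ y, ∫ x, K (x - y) * f y * φ x := by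
        congr 1 with y
        rw [← integral_const_mul]
        congr 1 with x
        ring
    _ = ∫ x, ∫ y, K (x - y) * f y * φ x := (integral_integral_swap hint).symm
    _ = _ := by
        congr 1 with x
        rw [kernelConv, integral_mul_const]

/-- Two locally integrable functions that represent the same distribution agree almost everywhere
on the common domain. -/
theorem RepresentedOn.ae_eq {u : 𝓢'(R3, ℂ)} {h₁ h₂ : R3 → ℂ} {U V : Set R3}
    (H₁ : RepresentedOn u h₁ U) (H₂ : RepresentedOn u h₂ V) (hU : IsOpen U) (hV : IsOpen V) :
    ∀ᵐ x, x ∈ U ∩ V → h₁ x = h₂ x := by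
  have hl₁ : LocallyIntegrableOn h₁ (U ∩ V) := H₁.1.mono_set Set.inter_subset_left
  have hl₂ : LocallyIntegrableOn h₂ (U ∩ V) := H₂.1.mono_set Set.inter_subset_right
  -- Fundamental lemma of the calculus of variations; its real test functions are cast to complex
  -- Schwartz functions.
  have key := (hU.inter hV).ae_eq_zero_of_integral_contDiff_smul_eq_zero (hl₁.sub hl₂) ?_
  · filter_upwards [key] with x hx hxU
    exact sub_eq_zero.mp (hx hxU)
  intro g hg hgc hgs
  have hc : HasCompactSupport fun x ↦ (g x : ℂ) := hgc.comp_left (g := Complex.ofReal) rfl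
  have hts : tsupport (fun x ↦ (g x : ℂ)) ⊆ tsupport g :=
    closure_mono (Function.support_comp_subset (g := Complex.ofReal) rfl g)
  let φ : 𝓢(R3, ℂ) := hc.toSchwartzMap (Complex.ofRealCLM.contDiff.comp hg)
  have e₁ := H₁.2 φ hc ((hts.trans hgs).trans Set.inter_subset_left)
  have e₂ := H₂.2 φ hc ((hts.trans hgs).trans Set.inter_subset_right)
  have hi : ∀ {h : R3 → ℂ}, LocallyIntegrableOn h (U ∩ V) → Integrable fun x ↦ g x • h x := by
    intro h hl
    have h1 : IntegrableOn (fun x ↦ g x • h x) (tsupport g) :=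
      (hl.integrableOn_compact_subset hgs hgc.isCompact).continuousOn_smul
        hg.continuous.continuousOn hgc.isCompact
    refine (integrableOn_iff_integrable_of_support_subset fun x hx ↦ subset_tsupport g ?_).mp h1
    exact fun h0 ↦ hx (by simp [h0])
  have hgh : ∀ h : R3 → ℂ, ∫ x, h x * φ x = ∫ x, g x • h x := fun h ↦ by
    congr 1 with x
    rw [Complex.real_smul, mul_comm]
    rfl
  simp only [Pi.sub_apply, smul_sub]
  rw [integral_sub (hi hl₁) (hi hl₂), ← hgh, ← hgh, ← e₁, ← e₂, sub_self]

theorem representedOn_kernelConv {m K : R3 → ℂ} (hm : IsZeroDegreeSymbol m) {C : ℝ} (hC : 0 < C)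
    (hK : StronglyMeasurable K) (hKb : ∀ x, x ≠ 0 → ‖K x‖ ≤ C * ‖x‖⁻¹ ^ 3)
    (hKm : ∀ (φ : 𝓢(R3, ℂ)) (y : R3), y ∉ tsupport φ →
      𝓕 (fun ξ ↦ m ξ * (𝓕⁻ φ) ξ) y = ∫ x, K (x - y) * φ x)
    {f : R3 → ℂ} (hf : Integrable f) :
    RepresentedOn (multiplierOp m hm f hf) (kernelConv K f) (essSupport f)ᶜ := by
  refine ⟨locallyIntegrableOn_kernelConv hC hK hKb hf, fun φ hφc hφs ↦ ?_⟩
  rw [multiplierOp_apply, ← integral_mul_integral_kernel hC hK hKb hf φ.integrable hφc hφs]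
  refine integral_congr_ae ?_
  filter_upwards [ae_eq_zero_of_notMem_essSupport f] with y hy
  by_cases hys : y ∈ essSupport f
  · rw [hKm φ y fun h ↦ hφs h hys]
  · simp [hy hys]

/-! ### The pairing estimate -/

/-- Working in `ℝ≥0∞` covers `δ = 0` and `δ = ∞` (empty support) uniformly; `hxf` alone keeps `x -
y` away from the singularity of `K`. -/
theorem enorm_kernelConv_le {K f : R3 → ℂ} {C : ℝ} (hC : 0 < C)
    (hKb : ∀ x, x ≠ 0 → ‖K x‖ ≤ C * ‖x‖⁻¹ ^ 3) (hf : Integrable f) {δ : ℝ≥0∞} {x : R3}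
    (hxf : x ∉ essSupport f) (hx : ∀ y ∈ essSupport f, δ ≤ edist x y) :
    ‖kernelConv K f x‖ₑ ≤ ENNReal.ofReal C * δ⁻¹ ^ 3 * eLpNorm f 1 volume := by
  rw [eLpNorm_one_eq_lintegral_enorm, ← lintegral_const_mul'' _ hf.aestronglyMeasurable.enorm]
  refine (enorm_integral_le_lintegral_enorm _).trans (lintegral_mono_ae ?_)
  filter_upwards [ae_eq_zero_of_notMem_essSupport f] with y hy
  by_cases hys : y ∈ essSupport f
  · have hne : x - y ≠ 0 := sub_ne_zero.mpr fun h ↦ hxf (h ▸ hys)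
    rw [enorm_mul]
    gcongr
    calc ‖K (x - y)‖ₑ ≤ ENNReal.ofReal (C * ‖x - y‖⁻¹ ^ 3) := by
          rw [← ofReal_norm]
          exact ENNReal.ofReal_le_ofReal (hKb _ hne)
      _ = ENNReal.ofReal C * (edist x y)⁻¹ ^ 3 := by
          rw [ENNReal.ofReal_mul hC.le, ENNReal.ofReal_pow (by positivity),
            ENNReal.ofReal_inv_of_pos (norm_pos_iff.mpr hne), edist_dist, dist_eq_norm]
      _ ≤ ENNReal.ofReal C * δ⁻¹ ^ 3 := by
          gcongr
          exact hx y hys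
  · simp [hy hys]

theorem setEDist_le_edist {s t : Set R3} {x y : R3} (hx : x ∈ s) (hy : y ∈ t) :
    setEDist s t ≤ edist x y :=
  (iInf₂_le x hx).trans (iInf₂_le y hy)

theorem lintegral_enorm_kernelConv_mul_le {K f g : R3 → ℂ} {C : ℝ} (hC : 0 < C)
    (hKb : ∀ x, x ≠ 0 → ‖K x‖ ≤ C * ‖x‖⁻¹ ^ 3) (hf : Integrable f) (hg : Integrable g)
    (hfg : Disjoint (essSupport f) (essSupport g)) :
    ∫⁻ x, ‖kernelConv K f x * g x‖ₑ ≤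
      ENNReal.ofReal C * (setEDist (essSupport f) (essSupport g))⁻¹ ^ 3 *
        eLpNorm g 1 volume * eLpNorm f 1 volume := by
  rw [mul_right_comm, eLpNorm_one_eq_lintegral_enorm (f := g),
    ← lintegral_const_mul'' _ hg.aestronglyMeasurable.enorm]
  refine lintegral_mono_ae ?_
  filter_upwards [ae_eq_zero_of_notMem_essSupport g] with x hx
  by_cases hxs : x ∈ essSupport g
  · rw [enorm_mul]
    gcongr
    refine enorm_kernelConv_le hC hKb hf (Set.disjoint_right.mp hfg hxs) fun y hy ↦ ?_
    rw [edist_comm]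
    exact setEDist_le_edist hy hxs
  · simp [hx hxs]

theorem exists_pairing_bound {m : R3 → ℂ} (hm : IsZeroDegreeSymbol m) :
    ∃ C : ℝ≥0, 0 < C ∧ ∀ (f g : R3 → ℂ) (hf : Integrable f) (_hg : Integrable g),
      Disjoint (essSupport f) (essSupport g) →
        (0 < setEDist (essSupport f) (essSupport g) →
          ∃ z : ℂ, HasPairing (multiplierOp m hm f hf) g z) ∧
        ∀ z : ℂ, HasPairing (multiplierOp m hm f hf) g z →
          ‖z‖ₑ ≤ C * ((setEDist (essSupport f) (essSupport g))⁻¹) ^ 3 *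
            eLpNorm g 1 volume * eLpNorm f 1 volume := by
  obtain ⟨K, C, hC, hK, hKb, hKm⟩ := hm.exists_kernel
  refine ⟨C.toNNReal, Real.toNNReal_pos.mpr hC, fun f g hf hg hfg ↦ ?_⟩
  have hrep := representedOn_kernelConv hm hC hK hKb hKm hf
  have hopen := (isClosed_essSupport f).isOpen_compl
  have hle := lintegral_enorm_kernelConv_mul_le hC hKb hf hg hfg
  refine ⟨fun hd ↦ ?_, ?_⟩
  · refine ⟨_, _, kernelConv K f, hopen, hfg.subset_compl_left, hrep, ⟨?_, ?_⟩, rfl⟩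
    · exact (aestronglyMeasurable_kernelConv hK hf).mul hg.aestronglyMeasurable
    · refine hle.trans_lt ?_
      have h1 := (memLp_one_iff_integrable.mpr hg).eLpNorm_lt_top
      have h2 := (memLp_one_iff_integrable.mpr hf).eLpNorm_lt_top
      refine ENNReal.mul_lt_top (ENNReal.mul_lt_top (ENNReal.mul_lt_top ENNReal.ofReal_lt_top ?_)
        h1) h2
      exact ENNReal.pow_lt_top (ENNReal.inv_lt_top.mpr hd)
  · rintro z ⟨U, h, hU, hgU, hrepU, -, rfl⟩
    -- The pairing does not depend on the choice of `U` and `h`: both densities agree almost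
    -- everywhere on the support of `g`.
    have heq : ∫ x, h x * g x = ∫ x, kernelConv K f x * g x := by
      refine integral_congr_ae ?_
      filter_upwards [hrepU.ae_eq hrep hU hopen, ae_eq_zero_of_notMem_essSupport g] with x h1 h2
      by_cases hxs : x ∈ essSupport g
      · rw [h1 ⟨hgU hxs, Set.disjoint_right.mp hfg hxs⟩]
      · simp [h2 hxs]
    rw [heq]
    exact (enorm_integral_le_lintegral_enorm _).trans hle

/-! ### Cylindrical regions and Riesz transforms -/

/-- Projection to the first two coordinates does not increase distances. -/
theorem cylRadius_le_add_dist (x y : R3) : cylRadius x ≤ cylRadius y + dist x y := by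
  have h : ∀ z : R3, cylRadius z = ‖(!₂[z 0, z 1] : EuclideanSpace ℝ (Fin 2))‖ := fun z ↦ by
    simp [cylRadius, EuclideanSpace.norm_eq, Fin.sum_univ_two]
  have hxy : ‖(!₂[x 0, x 1] : EuclideanSpace ℝ (Fin 2)) - !₂[y 0, y 1]‖ ≤ dist x y := by
    rw [dist_eq_norm, EuclideanSpace.norm_eq, EuclideanSpace.norm_eq]
    refine Real.sqrt_le_sqrt ?_
    simp only [Fin.sum_univ_two, Fin.sum_univ_three]
    simp
    positivity
  rw [h, h]
  calc _ = ‖(!₂[y 0, y 1] : EuclideanSpace ℝ (Fin 2)) + (!₂[x 0, x 1] - !₂[y 0, y 1])‖ := by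
        rw [add_sub_cancel]
    _ ≤ _ := (norm_add_le _ _).trans (by gcongr)

theorem exists_pairing_bound_of_cylRadius {m : R3 → ℂ} (hm : IsZeroDegreeSymbol m) {d : ℝ}
    (hd : 0 < d) :
    ∃ C : ℝ≥0, 0 < C ∧
      ∀ γ₁ γ₂ R : ℝ, 0 < γ₁ → 0 < γ₂ → γ₂ - γ₁ = d → 0 < R →
      ∀ (f g : R3 → ℂ) (hf : Integrable f) (_hg : Integrable g),
        essSupport f ⊆ {x | γ₂ * R ≤ cylRadius x} →
        essSupport g ⊆ {x | cylRadius x ≤ γ₁ * R} →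
          (∃ z : ℂ, HasPairing (multiplierOp m hm f hf) g z) ∧
          ∀ z : ℂ, HasPairing (multiplierOp m hm f hf) g z →
            ‖z‖ₑ ≤ C * ((ENNReal.ofReal R)⁻¹) ^ 3 *
              eLpNorm g 1 volume * eLpNorm f 1 volume := by
  obtain ⟨C, hC, H⟩ := exists_pairing_bound hm
  -- The supports are at distance at least `γ₂ R - γ₁ R = d R`, and `(d R)⁻³` splits into `d⁻³`,
  -- absorbed in the constant, and `R⁻³`.
  refine ⟨C * d.toNNReal⁻¹ ^ 3, by have := Real.toNNReal_pos.mpr hd; positivity,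
    fun γ₁ γ₂ R _ _ hγ hR f g hf hg hfs hgs ↦ ?_⟩
  have hdR : 0 < d * R := mul_pos hd hR
  have hdist : ENNReal.ofReal (d * R) ≤ setEDist (essSupport f) (essSupport g) := by
    refine le_iInf₂ fun x hx ↦ le_iInf₂ fun y hy ↦ ?_
    rw [edist_dist]
    refine ENNReal.ofReal_le_ofReal ?_
    have h1 : γ₂ * R ≤ cylRadius x := hfs hx
    have h2 : cylRadius y ≤ γ₁ * R := hgs hy
    have h3 := cylRadius_le_add_dist x y
    rw [← hγ, sub_mul]
    linarith
  have hpos := (ENNReal.ofReal_pos.mpr hdR).trans_le hdist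
  have hdisj : Disjoint (essSupport f) (essSupport g) := by
    refine Set.disjoint_left.mpr fun x hx hx' ↦ ?_
    have := setEDist_le_edist hx hx'
    rw [edist_self] at this
    exact hpos.not_ge this
  obtain ⟨h1, h2⟩ := H f g hf hg hdisj
  refine ⟨h1 hpos, fun z hz ↦ (h2 z hz).trans ?_⟩
  gcongr ?_ * _ * _
  rw [ENNReal.coe_mul, mul_assoc]
  refine mul_le_mul_right ?_ _
  calc (setEDist (essSupport f) (essSupport g))⁻¹ ^ 3 ≤ (ENNReal.ofReal (d * R))⁻¹ ^ 3 := by gcongr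
    _ = _ := by
      rw [ENNReal.coe_pow, ENNReal.coe_inv (Real.toNNReal_pos.mpr hd).ne', ← mul_pow,
        ENNReal.ofReal_mul hd.le, ENNReal.mul_inv (.inr ENNReal.ofReal_ne_top)
        (.inl ENNReal.ofReal_ne_top)]
      rfl

end ZeroDegree

theorem proposition2p1 :
    -- the general estimate for symbols that are homogeneous of degree zero
    (∀ (m : R3 → ℂ) (hm : IsZeroDegreeSymbol m), ∃ C : ℝ≥0, 0 < C ∧
      ∀ (f g : R3 → ℂ) (hf : Integrable f) (_hg : Integrable g),
        Disjoint (essSupport f) (essSupport g) →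
          (0 < setEDist (essSupport f) (essSupport g) →
            ∃ z : ℂ, HasPairing (multiplierOp m hm f hf) g z) ∧
          ∀ z : ℂ, HasPairing (multiplierOp m hm f hf) g z →
            ‖z‖ₑ ≤ C * ((setEDist (essSupport f) (essSupport g))⁻¹) ^ 3 *
              eLpNorm g 1 volume * eLpNorm f 1 volume) ∧
    -- fourth powers of the Riesz transforms
    (∀ (i : Fin 3) (d : ℝ), 0 < d → ∃ C : ℝ≥0, 0 < C ∧
      ∀ γ₁ γ₂ R : ℝ, 0 < γ₁ → 0 < γ₂ → γ₂ - γ₁ = d → 0 < R →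
      ∀ (f g : R3 → ℂ) (hf : Integrable f) (_hg : Integrable g),
        essSupport f ⊆ {x | γ₂ * R ≤ cylRadius x} →
        essSupport g ⊆ {x | cylRadius x ≤ γ₁ * R} →
          (∃ z : ℂ, HasPairing (multiplierOp (rieszSymbol i ^ 4)
            ((isZeroDegreeSymbol_riesz i).pow 4) f hf) g z) ∧
          ∀ z : ℂ, HasPairing (multiplierOp (rieszSymbol i ^ 4)
            ((isZeroDegreeSymbol_riesz i).pow 4) f hf) g z →
            ‖z‖ₑ ≤ C * ((ENNReal.ofReal R)⁻¹) ^ 3 *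
              eLpNorm g 1 volume * eLpNorm f 1 volume) ∧
    -- products of squares of Riesz transforms
    (∀ (k h : Fin 3) (d : ℝ), 0 < d → ∃ C : ℝ≥0, 0 < C ∧
      ∀ γ₁ γ₂ R : ℝ, 0 < γ₁ → 0 < γ₂ → γ₂ - γ₁ = d → 0 < R →
      ∀ (f g : R3 → ℂ) (hf : Integrable f) (_hg : Integrable g),
        essSupport f ⊆ {x | γ₂ * R ≤ cylRadius x} →
        essSupport g ⊆ {x | cylRadius x ≤ γ₁ * R} →
          (∃ z : ℂ, HasPairing (multiplierOp (rieszSymbol k ^ 2 * rieszSymbol h ^ 2)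
            (((isZeroDegreeSymbol_riesz k).pow 2).mul ((isZeroDegreeSymbol_riesz h).pow 2))
            f hf) g z) ∧
          ∀ z : ℂ, HasPairing (multiplierOp (rieszSymbol k ^ 2 * rieszSymbol h ^ 2)
            (((isZeroDegreeSymbol_riesz k).pow 2).mul ((isZeroDegreeSymbol_riesz h).pow 2))
            f hf) g z →
            ‖z‖ₑ ≤ C * ((ENNReal.ofReal R)⁻¹) ^ 3 *
              eLpNorm g 1 volume * eLpNorm f 1 volume) := by
  exact ⟨fun m hm ↦ exists_pairing_bound hm,
    fun i d hd ↦ exists_pairing_bound_of_cylRadius ((isZeroDegreeSymbol_riesz i).pow 4) hd,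
    fun k h d hd ↦ exists_pairing_bound_of_cylRadius
      (((isZeroDegreeSymbol_riesz k).pow 2).mul ((isZeroDegreeSymbol_riesz h).pow 2)) hd⟩
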